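/- Let $n,p$ be natural numbers and let $C^*(\mathbb F_n)$ be the full group C$^*$-algebra of the free group on $n$ generators, i.e. the norm closure of the image of the group algebra $\mathbb C[\mathbb F_n]$ under the direct sum of all its unitary representations on Hilbert spaces. Call $u_1,\dots,u_n\in C^*(\mathbb F_n)$ universal unitaries if they are unitary and if for every nonzero complex Hilbert space $H$ and all unitaries $v_1,\dots,v_n\in B(H)$ there is a unique unital $*$-homomorphism $\pi:C^*(\mathbb F_n)\to B(H)$ with $\pi(u_i)=v_i$ for all $i$ (for instance, the canonical generators are universal unitaries). Let $M_p$ be the algebra of complex $p\times p$ matrices, and regard $C^*(\mathbb F_n)\otimes M_p=M_p(C^*(\mathbb F_n))$ as a C$^*$-algebra, where $a\otimes M$ is the matrix $[m_{kl}a]_{k,l}$ for $M=[m_{kl}]$. Theorem. Let $u_1,\dots,u_n\in C^*(\mathbb F_n)$ be universal unitaries and let $A_{ij}\in M_p$ for $1\le i,j\le n$. Then the element $$P=\sum_{i,j=1}^n u_iu_j^*\otimes A_{ij}$$ is positive in the C$^*$-algebra $C^*(\mathbb F_n)\otimes M_p$ if and only if there exist matrices $X_{ik}\in M_p$, $1\le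 i,k\le n$, such that $$P=\sum_{k=1}^n Y_kY_k^*,\qquad\text{where } Y_k=\sum_{i=1}^n u_i\otimes X_{ik}.$$ -/

import Mathlib

open scoped ENNReal

universe u

/-- A unitary representation of the (discrete) group `G` on a nonzero complex Hilbert space. -/
structure UnitaryRep (G : Type u) [Group G] where
  H : Type u
  [instNormed : NormedAddCommGroup H]
  [instInner : InnerProductSpace ℂ H]
  [instComplete : CompleteSpace H]
  [instNontrivial : Nontrivial H]
  rep : G →* unitary (H →L[ℂ] H)

attribute [instance] UnitaryRep.instNormed UnitaryRep.instInner UnitaryRep.instComplete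
  UnitaryRep.instNontrivial

/-- The C⋆-algebra of all bounded families of operators `(T_π)_π`, `T_π ∈ B(H_π)`, where `π` runs
over all unitary representations of `G`; the norm is the supremum norm, the operations are
pointwise. -/
abbrev UnitaryRep.Prod (G : Type u) [Group G] : Type (u + 1) :=
  lp (fun π : UnitaryRep G => π.H →L[ℂ] π.H) ∞

noncomputable instance UnitaryRep.instCStarAlgebraProd (G : Type u) [Group G] :
    CStarAlgebra (UnitaryRep.Prod G) where

/-- The universal representation of `G`: the family `(π(g))_π`. -/
noncomputable def UnitaryRep.universal (G : Type u) [Group G] (g : G) : UnitaryRep.Prod G :=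
  ⟨fun π => (π.rep g : π.H →L[ℂ] π.H), memℓp_infty ⟨1, by
    rintro _ ⟨π, rfl⟩
    exact CStarRing.norm_of_mem_unitary (π.rep g).2 |>.le⟩⟩

/-- The full group C⋆-algebra of `G` as a C⋆-subalgebra: the norm closure of the image of the
group algebra under the universal representation.  Thus the norm of (the image of) `x ∈ ℂ[G]` is
`sup ‖π(x)‖`, the supremum running over all unitary representations `π` of `G`. -/
noncomputable def fullGroupCStarSubalgebra (G : Type u) [Group G] :
    StarSubalgebra ℂ (UnitaryRep.Prod G) :=
  (StarAlgebra.adjoin ℂ (Set.range (UnitaryRep.universal G))).topologicalClosure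

/-- The full group C⋆-algebra `C⋆(G)` of the discrete group `G`. -/
def FullGroupCStar (G : Type u) [Group G] : Type (u + 1) :=
  fullGroupCStarSubalgebra G

namespace FullGroupCStar

variable (G : Type u) [Group G]

instance isClosed_subalgebra :
    IsClosed (fullGroupCStarSubalgebra G : Set (UnitaryRep.Prod G)) :=
  StarSubalgebra.isClosed_topologicalClosure _

noncomputable instance instCStarAlgebra : CStarAlgebra (FullGroupCStar G) :=
  inferInstanceAs (CStarAlgebra (fullGroupCStarSubalgebra G))

/-- The usual order of a C⋆-algebra: `a ≤ b` iff `b - a` is a positive element. -/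
noncomputable instance instPartialOrder : PartialOrder (FullGroupCStar G) :=
  CStarAlgebra.spectralOrder _

instance instStarOrderedRing : StarOrderedRing (FullGroupCStar G) :=
  CStarAlgebra.spectralOrderedRing _

variable {G}

/-- The canonical image of a group element in `C⋆(G)`. -/
noncomputable def of (g : G) : FullGroupCStar G :=
  ⟨UnitaryRep.universal G g, StarSubalgebra.le_topologicalClosure _
    (StarAlgebra.subset_adjoin ℂ _ (Set.mem_range_self g))⟩

end FullGroupCStar

/-- The elements `u₁, …, uₙ` of the unital C⋆-algebra `A` are universal unitaries for `A`: they are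
unitary and for all unitaries `v₁, …, vₙ` on a (nonzero) Hilbert space `H` there is a unique unital
`*`-homomorphism `π : A → B(H)` with `π(uᵢ) = vᵢ` for all `i`. -/
def IsUniversalUnitaries {A : Type*} [CStarAlgebra A] {n : ℕ} (w : Fin n → A) : Prop :=
  (∀ i, w i ∈ unitary A) ∧
    ∀ (H : Type) [NormedAddCommGroup H] [InnerProductSpace ℂ H] [CompleteSpace H] [Nontrivial H]
      (v : Fin n → H →L[ℂ] H), (∀ i, v i ∈ unitary (H →L[ℂ] H)) →
        ∃! π : A →⋆ₐ[ℂ] (H →L[ℂ] H), ∀ i, π (w i) = v i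

/-- The elementary tensor `a ⊗ M` in `A ⊗ M_p = M_p(A)`: the matrix with entries `M k l • a`. -/
def elemTensor {A : Type*} [CStarAlgebra A] {p : ℕ} (a : A) (M : Matrix (Fin p) (Fin p) ℂ) :
    CStarMatrix (Fin p) (Fin p) A :=
  CStarMatrix.ofMatrix (M.map fun c => c • a)

namespace FullGroupCStar

theorem of_mem_unitary {G : Type u} [Group G] (g : G) : of g ∈ unitary (FullGroupCStar G) := by
  rw [Unitary.mem_iff]
  constructor <;>
  · apply Subtype.ext
    apply Subtype.ext
    funext π
    first
      | exact Unitary.star_mul_self_of_mem (π.rep g).2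
      | exact Unitary.mul_star_self_of_mem (π.rep g).2

/-- The coordinate projection of `C⋆(G)` belonging to a unitary representation `π` of `G`, that is,
the extension of `π` to `C⋆(G)`. -/
noncomputable def eval {G : Type u} [Group G] (π : UnitaryRep G) :
    FullGroupCStar G →⋆ₐ[ℂ] (π.H →L[ℂ] π.H) where
  toFun x := x.1.1 π
  map_one' := rfl
  map_mul' _ _ := rfl
  map_zero' := rfl
  map_add' _ _ := rfl
  commutes' _ := rfl
  map_star' _ := rfl

/-- A `*`-homomorphism on `C⋆(G)` is determined by its values on `G`. -/
theorem hom_ext {G : Type u} [Group G] {B : Type*} [CStarAlgebra B]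
    {f g : FullGroupCStar G →⋆ₐ[ℂ] B} (h : ∀ a : G, f (of a) = g (of a)) : f = g := by
  let f' : (fullGroupCStarSubalgebra G) →⋆ₐ[ℂ] B := f
  let g' : (fullGroupCStarSubalgebra G) →⋆ₐ[ℂ] B := g
  suffices f' = g' from this
  have hf : Continuous f' :=
    AddMonoidHomClass.continuous_of_bound f 1 fun a => by
      simpa using NonUnitalStarAlgHom.norm_apply_le f a
  have hg : Continuous g' :=
    AddMonoidHomClass.continuous_of_bound g 1 fun a => by
      simpa using NonUnitalStarAlgHom.norm_apply_le g a
  refine StarAlgHom.ext_topologicalClosure (S := StarAlgebra.adjoin ℂ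
    (Set.range (UnitaryRep.universal G))) hf hg ?_
  refine StarAlgHom.ext_adjoin ?_
  rintro ⟨_, hx⟩ ⟨a, rfl⟩
  exact h a

/-- The canonical generators of `C⋆(F_n)` are universal unitaries. -/
theorem isUniversalUnitaries_of (n : ℕ) :
    IsUniversalUnitaries (fun i : Fin n => of (FreeGroup.of i)) := by
  refine ⟨fun i => of_mem_unitary _, fun H _ _ _ _ v hv => ?_⟩
  let π : UnitaryRep (FreeGroup (Fin n)) :=
    { H := H, rep := FreeGroup.lift fun i => (⟨v i, hv i⟩ : unitary (H →L[ℂ] H)) }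
  have hπ : ∀ i, eval π (of (FreeGroup.of i)) = v i := by
    intro i
    change ((FreeGroup.lift fun i => (⟨v i, hv i⟩ : unitary (H →L[ℂ] H))) (FreeGroup.of i)).1 = v i
    rw [FreeGroup.lift_apply_of]
  refine ⟨eval π, hπ, fun f hf => hom_ext fun a => ?_⟩
  have key : ∀ φ : FullGroupCStar (FreeGroup (Fin n)) →⋆ₐ[ℂ] (H →L[ℂ] H),
      ∃ ρ : FreeGroup (Fin n) →* (H →L[ℂ] H), ∀ a, ρ a = φ (of a) := fun φ =>
    ⟨{ toFun := fun a => φ (of a)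
       map_one' := by
         have : (of 1 : FullGroupCStar (FreeGroup (Fin n))) = 1 := by
           apply Subtype.ext; apply Subtype.ext; funext σ
           exact congrArg Subtype.val (map_one σ.rep)
         rw [this, map_one]
       map_mul' := fun x y => by
         have : (of (x * y) : FullGroupCStar (FreeGroup (Fin n))) = of x * of y := by
           apply Subtype.ext; apply Subtype.ext; funext σ
           exact congrArg Subtype.val (map_mul σ.rep x y)
         rw [this, map_mul] }, fun _ => rfl⟩
  obtain ⟨ρ, hρ⟩ := key f
  obtain ⟨σ, hσ⟩ := key (eval π)
  rw [← hρ, ← hσ]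
  congr 1
  refine FreeGroup.ext_hom _ _ fun i => ?_
  rw [hρ, hσ, hπ]
  exact hf i

end FullGroupCStar

/-! ### Separation from the cone of positive semidefinite matrices -/

section Separation
open Matrix
open scoped ComplexOrder Pointwise

variable {ι : Type*} [Fintype ι]

/-! Since `uᵢuᵢ* = 1`, the element `P` sees the block matrix `B = (Aᵢⱼ)` only modulo the space `L`
of block diagonal matrices whose diagonal blocks sum to zero. If `B = M Mᴴ + D` with `D ∈ L`, the
block columns of `M` give the `Yₖ`.

Otherwise, with `B` made Hermitian, Hahn–Banach yields a real functional `f` with `f B < 0`,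
nonnegative on positive semidefinite matrices and zero on `L`; this needs the cone plus `L` to be
closed. Its density matrix is positive semidefinite with equal diagonal blocks, hence the Gram
matrix of vectors `x (i, k)` such that the families `(x (i, k))ₖ` have the same Gram matrix for all
`i`. So unitaries `Uᵢ` carry `x (0, k)` to `x (i, k)`. The representation with `uᵢ ↦ Uᵢ*` turns `P ≥
0`, tested on the vectors `x (0, k)`, into `f B ≥ 0`, a contradiction. The converse is positivity of
a sum of squares. -/

theorem Matrix.locallyConvexSpace_real : LocallyConvexSpace ℝ (Matrix ι ι ℂ) :=
  inferInstanceAs (LocallyConvexSpace ℝ (ι → ι → ℂ))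

theorem Matrix.re_trace_mul_conjTranspose_self (M : Matrix ι ι ℂ) :
    (M * Mᴴ).trace.re = ∑ a, ∑ b, ‖M a b‖ ^ 2 := by
  simp [Matrix.trace, Matrix.mul_apply, Complex.mul_conj, Complex.normSq_eq_norm_sq, -Complex.ofReal_pow]

open scoped MatrixOrder Matrix.Norms.L2Operator in
theorem Matrix.PosSemidef.exists_eq_conjTranspose_mul_self {B : Matrix ι ι ℂ}
    (hB : B.PosSemidef) : ∃ M : Matrix ι ι ℂ, B = Mᴴ * M := by
  classical
  exact CStarAlgebra.nonneg_iff_eq_star_mul_self.mp hB.nonneg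

/-- Positive semidefinite matrices of bounded trace form a compact set. -/
theorem Matrix.isCompact_posSemidef_trace_le (R : ℝ) :
    IsCompact {B : Matrix ι ι ℂ | B.PosSemidef ∧ B.trace.re ≤ R} := by
  classical
  -- The trace of `M Mᴴ` is the squared Hilbert–Schmidt norm, so these `M` form a compact set whose
  -- image under `M ↦ M Mᴴ` is the required one.
  have hK : IsCompact {M : Matrix ι ι ℂ | (M * Mᴴ).trace.re ≤ R} := by
    refine IsCompact.of_isClosed_subset
      (isCompact_univ_pi fun _ : ι => isCompact_univ_pi fun _ : ι =>
        isCompact_closedBall (0 : ℂ) (√R)) ?_ ?_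
    · exact isClosed_le (by fun_prop) continuous_const
    · intro M hM a _ b _
      rw [Set.mem_ofPred_eq, re_trace_mul_conjTranspose_self] at hM
      rw [mem_closedBall_zero_iff]
      apply Real.le_sqrt_of_sq_le
      calc ‖M a b‖ ^ 2 ≤ ∑ b, ‖M a b‖ ^ 2 :=
            Finset.single_le_sum (f := fun b => ‖M a b‖ ^ 2) (fun _ _ => by positivity)
              (Finset.mem_univ b)
        _ ≤ ∑ a, ∑ b, ‖M a b‖ ^ 2 :=
            Finset.single_le_sum (f := fun a => ∑ b, ‖M a b‖ ^ 2) (fun _ _ => by positivity)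
              (Finset.mem_univ a)
        _ ≤ R := hM
  convert hK.image (f := fun M : Matrix ι ι ℂ => M * Mᴴ) (by fun_prop) using 1
  ext B
  constructor
  · rintro ⟨h, hR⟩
    obtain ⟨N, rfl⟩ := h.exists_eq_conjTranspose_mul_self
    exact ⟨Nᴴ, by simpa using hR, by simp⟩
  · rintro ⟨M, hM, rfl⟩
    exact ⟨Matrix.posSemidef_self_mul_conjTranspose M, hM⟩

/-- A sum of closed cones need not be closed. Here the trace ignores `L`, so near a limit point the
positive summands have bounded trace and stay in a compact set. -/
theorem Matrix.isClosed_posSemidef_add (L : Submodule ℝ (Matrix ι ι ℂ))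
    (hL : ∀ D ∈ L, D.trace = 0) :
    IsClosed ({B : Matrix ι ι ℂ | B.PosSemidef} + (L : Set (Matrix ι ι ℂ))) := by
  rw [← closure_subset_iff_isClosed]
  intro x hx
  have hC : IsClosed ({B : Matrix ι ι ℂ | B.PosSemidef ∧ B.trace.re ≤ x.trace.re + 1} +
      (L : Set (Matrix ι ι ℂ))) :=
    L.closed_of_finiteDimensional.add_left_of_isCompact (isCompact_posSemidef_trace_le _)
  have hO : IsOpen {y : Matrix ι ι ℂ | y.trace.re < x.trace.re + 1} :=
    isOpen_lt (by fun_prop) continuous_const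
  have h1 := hO.inter_closure ⟨show x.trace.re < x.trace.re + 1 by linarith, hx⟩
  have h2 := hC.closure_subset_iff.mpr ?_ h1
  · exact Set.add_subset_add_right (fun B hB => hB.1) h2
  · rintro _ ⟨hy, B, hB, D, hD, rfl⟩
    refine ⟨B, ⟨hB, ?_⟩, D, hD, rfl⟩
    have : (B + D).trace.re < x.trace.re + 1 := hy
    rw [Matrix.trace_add, hL D hD, add_zero] at this
    exact this.le

theorem Matrix.exists_functional_of_notMem_posSemidef_add (L : Submodule ℝ (Matrix ι ι ℂ))
    (hL : ∀ D ∈ L, D.trace = 0) {A : Matrix ι ι ℂ}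
    (hA : A ∉ {B : Matrix ι ι ℂ | B.PosSemidef} + (L : Set (Matrix ι ι ℂ))) :
    ∃ f : Matrix ι ι ℂ →ₗ[ℝ] ℝ, f A < 0 ∧ (∀ B : Matrix ι ι ℂ, B.PosSemidef → 0 ≤ f B) ∧
      ∀ D ∈ L, f D = 0 := by
  have : LocallyConvexSpace ℝ (Matrix ι ι ℂ) := Matrix.locallyConvexSpace_real
  have hconv : Convex ℝ {B : Matrix ι ι ℂ | B.PosSemidef} := by
    intro B hB C hC s t hs ht _
    exact (PosSemidef.smul hB hs).add (PosSemidef.smul hC ht)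
  obtain ⟨f, s, hfA, hf⟩ := geometric_hahn_banach_point_closed (hconv.add L.convex)
    (isClosed_posSemidef_add L hL) hA
  have hf' : ∀ B : Matrix ι ι ℂ, B.PosSemidef → ∀ D ∈ L, s < f B + f D := fun B hB D hD => by
    rw [← map_add]
    exact hf _ ⟨B, hB, D, hD, rfl⟩
  have hs : s < 0 := by simpa using hf' 0 PosSemidef.zero 0 L.zero_mem
  -- A linear function bounded below on a ray is nonnegative there; applied to scalings within the
  -- cone and within `L`.
  have key : ∀ r : ℝ, (∀ c : ℝ, 0 ≤ c → s < c * r) → 0 ≤ r := by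
    intro r hr
    by_contra! h
    have := hr (s / r) (div_nonneg_of_nonpos hs.le h.le)
    rw [div_mul_cancel₀ _ h.ne] at this
    exact this.false
  have hD : ∀ D ∈ L, 0 ≤ f D := fun D hD => key _ fun c _ => by
    simpa using hf' 0 PosSemidef.zero (c • D) (L.smul_mem c hD)
  refine ⟨f.toLinearMap, hfA.trans hs, fun B hB => key _ fun c hc => ?_, fun D h => ?_⟩
  · simpa using hf' (c • B) (PosSemidef.smul hB hc) 0 L.zero_mem
  · refine le_antisymm ?_ (hD D h)
    have := hD (-D) (L.neg_mem h)
    rw [map_neg] at this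
    exact neg_nonneg.mp this

end Separation

/-! ### Unitaries from equal Gram matrices -/

section GramUnitary

/-- Two finite families with the same Gram matrix in a finite-dimensional Hilbert space are
related by a unitary. -/
theorem exists_linearIsometryEquiv_of_inner_eq {κ V : Type*} [Fintype κ]
    [NormedAddCommGroup V] [InnerProductSpace ℂ V] [FiniteDimensional ℂ V] (x y : κ → V)
    (h : ∀ k l, inner ℂ (x k) (x l) = inner ℂ (y k) (y l)) :
    ∃ U : V ≃ₗᵢ[ℂ] V, ∀ k, U (x k) = y k := by
  classical
  let f : (κ → ℂ) →ₗ[ℂ] V := Fintype.linearCombination ℂ x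
  let g : (κ → ℂ) →ₗ[ℂ] V := Fintype.linearCombination ℂ y
  have hfg : ∀ c, ‖f c‖ = ‖g c‖ := fun c => by
    have : inner ℂ (f c) (f c) = inner ℂ (g c) (g c) := by
      simp only [f, g, Fintype.linearCombination_apply, sum_inner, inner_sum, inner_smul_left,
        inner_smul_right, h]
    rw [norm_eq_sqrt_re_inner (𝕜 := ℂ), norm_eq_sqrt_re_inner (𝕜 := ℂ), this]
  have hker : LinearMap.ker f ≤ LinearMap.ker g := fun c hc => by
    rw [LinearMap.mem_ker] at hc ⊢
    rw [← norm_eq_zero, ← hfg, hc, norm_zero]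
  -- The map `f c ↦ g c` is well defined and isometric by `hfg`; finite dimension lets it extend to
  -- a unitary of `V`.
  let φ : LinearMap.range f →ₗ[ℂ] V :=
    ((LinearMap.ker f).liftQ g hker).comp f.quotKerEquivRange.symm.toLinearMap
  have hφ : ∀ c, φ ⟨f c, LinearMap.mem_range_self f c⟩ = g c := fun c => by
    have : f.quotKerEquivRange.symm ⟨f c, LinearMap.mem_range_self f c⟩ =
        (LinearMap.ker f).mkQ c := f.quotKerEquivRange_symm_apply_image c _
    simp only [φ, LinearMap.comp_apply, LinearEquiv.coe_coe, this, Submodule.mkQ_apply,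
      Submodule.liftQ_apply]
  let ψ : LinearMap.range f →ₗᵢ[ℂ] V :=
    { toLinearMap := φ
      norm_map' := by
        rintro ⟨_, c, rfl⟩
        rw [hφ, ← hfg]
        rfl }
  refine ⟨ψ.extend.toLinearIsometryEquiv rfl, fun k => ?_⟩
  have hx : f (Pi.single k 1) = x k := by simp [f]
  have hy : g (Pi.single k 1) = y k := by simp [g]
  have := ψ.extend_apply ⟨f (Pi.single k 1), LinearMap.mem_range_self f _⟩
  rw [LinearIsometry.coe_toLinearIsometryEquiv, ← hx, ← hy, this]
  exact hφ _

end GramUnitary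

/-! ### Density matrices of real functionals -/

section Density
open Matrix
open scoped ComplexOrder

variable {ι : Type*} [Fintype ι] [DecidableEq ι]

/-- The Hermitian matrix representing a real functional on Hermitian matrices. -/
noncomputable def Matrix.density (f : Matrix ι ι ℂ →ₗ[ℝ] ℝ) : Matrix ι ι ℂ :=
  fun a b => ((f (single a b 1) - Complex.I * f (single a b Complex.I)) +
    (f (single b a 1) + Complex.I * f (single b a Complex.I))) / 2

omit [Fintype ι] in
theorem Matrix.isHermitian_density (f : Matrix ι ι ℂ →ₗ[ℝ] ℝ) : (density f).IsHermitian := by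
  ext a b
  simp only [conjTranspose_apply, density, RCLike.star_def, map_div₀, map_add, map_sub, map_mul,
    Complex.conj_ofReal, Complex.conj_I, map_ofNat]
  ring

theorem Matrix.functional_eq_sum (f : Matrix ι ι ℂ →ₗ[ℝ] ℝ) (X : Matrix ι ι ℂ) :
    f X = ∑ a, ∑ b, ((X a b).re * f (single a b 1) + (X a b).im * f (single a b Complex.I)) := by
  conv_lhs => rw [matrix_eq_sum_single X]
  simp only [map_sum]
  refine Finset.sum_congr rfl fun a _ => Finset.sum_congr rfl fun b _ => ?_
  have : single a b (X a b) =
      (X a b).re • single a b (1 : ℂ) + (X a b).im • single a b Complex.I := by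
    rw [smul_single, smul_single, ← single_add]
    congr 1
    simp
  rw [this, map_add, map_smul, map_smul, smul_eq_mul, smul_eq_mul]

/-- The density is the Hermitian part of a matrix `z` with `Re ∑ X z = f X`; for Hermitian `X`,
passing to the Hermitian part takes the real part of the pairing. -/
theorem Matrix.sum_mul_density (f : Matrix ι ι ℂ →ₗ[ℝ] ℝ) {X : Matrix ι ι ℂ}
    (hX : X.IsHermitian) : ∑ a, ∑ b, X a b * density f a b = f X := by
  let z : Matrix ι ι ℂ := fun a b => f (single a b 1) - Complex.I * f (single a b Complex.I)
  have hz : ∀ a b, density f a b = (z a b + star (z b a)) / 2 := fun a b => by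
    simp [density, z]
  have h1 : (∑ a, ∑ b, X a b * z a b).re = f X := by
    rw [functional_eq_sum f X]
    simp [z, Complex.mul_re]
  have h2 : ∑ a, ∑ b, X a b * star (z b a) = star (∑ a, ∑ b, X a b * z a b) := by
    rw [Finset.sum_comm]
    simp only [star_sum, star_mul']
    refine Finset.sum_congr rfl fun a _ => Finset.sum_congr rfl fun b _ => ?_
    rw [← hX.apply]
  have : ∑ a, ∑ b, X a b * density f a b =
      ((∑ a, ∑ b, X a b * z a b) + star (∑ a, ∑ b, X a b * z a b)) / 2 := by
    rw [← h2, ← Finset.sum_add_distrib, Finset.sum_div]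
    refine Finset.sum_congr rfl fun a _ => ?_
    rw [← Finset.sum_add_distrib, Finset.sum_div]
    refine Finset.sum_congr rfl fun b _ => ?_
    rw [hz]
    ring
  rw [this, ← h1, RCLike.star_def, Complex.add_conj]
  push_cast
  ring

theorem Matrix.posSemidef_density {f : Matrix ι ι ℂ →ₗ[ℝ] ℝ}
    (hf : ∀ B : Matrix ι ι ℂ, B.PosSemidef → 0 ≤ f B) : (density f).PosSemidef := by
  refine .of_dotProduct_mulVec_nonneg (isHermitian_density f) fun x => ?_
  have hB := posSemidef_vecMulVec_star_self x
  have : star x ⬝ᵥ density f *ᵥ x = f (vecMulVec (star x) x) := by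
    rw [← sum_mul_density f hB.1]
    simp only [dotProduct, mulVec, Finset.mul_sum, vecMulVec_apply]
    exact Finset.sum_congr rfl fun a _ => Finset.sum_congr rfl fun b _ => by ring
  rw [this]
  exact_mod_cast hf _ hB

end Density

/-! ### Block matrices and the elements they represent -/

section ElemTensor
open Matrix

variable {A : Type*} [CStarAlgebra A] {p n : ℕ}

theorem elemTensor_apply (a : A) (M : Matrix (Fin p) (Fin p) ℂ) (k l : Fin p) :
    elemTensor a M k l = M k l • a := rfl

theorem CStarMatrix.sum_apply {κ : Type*} (s : Finset κ) (f : κ → CStarMatrix (Fin p) (Fin p) A)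
    (k l : Fin p) : (∑ m ∈ s, f m) k l = ∑ m ∈ s, f m k l :=
  Matrix.sum_apply k l s f

/-- The element `∑ uᵢuⱼ* ⊗ Bᵢⱼ`, for a matrix `B` with blocks `Bᵢⱼ`. -/
noncomputable def blockTensor (u : Fin n → A) (B : Matrix (Fin n × Fin p) (Fin n × Fin p) ℂ) :
    CStarMatrix (Fin p) (Fin p) A :=
  ∑ i, ∑ j, elemTensor (u i * star (u j)) (Matrix.of fun k l => B (i, k) (j, l))

theorem blockTensor_apply (u : Fin n → A) (B : Matrix (Fin n × Fin p) (Fin n × Fin p) ℂ)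
    (k l : Fin p) :
    blockTensor u B k l = ∑ i, ∑ j, B (i, k) (j, l) • (u i * star (u j)) := by
  simp only [blockTensor, CStarMatrix.sum_apply, elemTensor_apply, of_apply]

theorem blockTensor_add (u : Fin n → A) (B C : Matrix (Fin n × Fin p) (Fin n × Fin p) ℂ) :
    blockTensor u (B + C) = blockTensor u B + blockTensor u C := by
  ext k l
  simp only [CStarMatrix.add_apply, blockTensor_apply, Matrix.add_apply, add_smul,
    Finset.sum_add_distrib]

theorem blockTensor_smul (u : Fin n → A) (c : ℂ)
    (B : Matrix (Fin n × Fin p) (Fin n × Fin p) ℂ) :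
    blockTensor u (c • B) = c • blockTensor u B := by
  ext k l
  simp only [CStarMatrix.smul_apply, blockTensor_apply, Matrix.smul_apply, smul_assoc,
    Finset.smul_sum]

theorem blockTensor_conjTranspose (u : Fin n → A)
    (B : Matrix (Fin n × Fin p) (Fin n × Fin p) ℂ) :
    blockTensor u Bᴴ = star (blockTensor u B) := by
  ext k l
  rw [CStarMatrix.star_apply, blockTensor_apply, blockTensor_apply, Finset.sum_comm]
  simp only [star_sum, star_smul, star_mul, star_star, conjTranspose_apply]

/-- Each of the `n` block columns of the square matrix `M` contributes one square, whence exactly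
`n` terms. -/
theorem blockTensor_mul_conjTranspose (u : Fin n → A)
    (M : Matrix (Fin n × Fin p) (Fin n × Fin p) ℂ) :
    blockTensor u (M * Mᴴ) =
      ∑ m, (∑ i, elemTensor (u i) (Matrix.of fun k q => M (i, k) (m, q))) *
        star (∑ i, elemTensor (u i) (Matrix.of fun k q => M (i, k) (m, q))) := by
  ext k l
  simp only [CStarMatrix.sum_apply, CStarMatrix.mul_apply, CStarMatrix.star_apply,
    blockTensor_apply, Matrix.mul_apply, elemTensor_apply, star_sum, star_smul, Finset.sum_mul_sum,
    of_apply, conjTranspose_apply, smul_mul_smul_comm, Finset.sum_smul, Fintype.sum_prod_type]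
  calc _ = ∑ i, ∑ m, ∑ j, ∑ q, (M (i, k) (m, q) * star (M (j, l) (m, q))) • (u i * star (u j)) :=
        Finset.sum_congr rfl fun i _ => Finset.sum_comm
    _ = _ := Finset.sum_comm

/-- Block diagonal matrices whose diagonal blocks add up to zero. -/
def blockDiagonalSumZero (n p : ℕ) : Submodule ℝ (Matrix (Fin n × Fin p) (Fin n × Fin p) ℂ) where
  carrier := {D | (∀ i j k l, i ≠ j → D (i, k) (j, l) = 0) ∧ ∀ k l, ∑ i, D (i, k) (i, l) = 0}
  add_mem' := fun ⟨h1, h2⟩ ⟨h3, h4⟩ =>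
    ⟨fun i j k l h => by simp [h1 i j k l h, h3 i j k l h],
      fun k l => by simp [Finset.sum_add_distrib, h2, h4]⟩
  zero_mem' := by simp
  smul_mem' := fun c _ ⟨h1, h2⟩ =>
    ⟨fun i j k l h => by simp [h1 i j k l h],
      fun k l => by simp only [Matrix.smul_apply, ← Finset.smul_sum, h2, smul_zero]⟩

theorem trace_eq_zero_of_mem_blockDiagonalSumZero
    {D : Matrix (Fin n × Fin p) (Fin n × Fin p) ℂ} (hD : D ∈ blockDiagonalSumZero n p) :
    D.trace = 0 := by
  rw [Matrix.trace, Fintype.sum_prod_type, Finset.sum_comm]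
  exact Finset.sum_eq_zero fun k _ => hD.2 k k

theorem blockTensor_eq_zero {u : Fin n → A} (hu : ∀ i, u i ∈ unitary A)
    {D : Matrix (Fin n × Fin p) (Fin n × Fin p) ℂ} (hD : D ∈ blockDiagonalSumZero n p) :
    blockTensor u D = 0 := by
  ext k l
  have : ∀ i, ∑ j, D (i, k) (j, l) • (u i * star (u j)) = D (i, k) (i, l) • (1 : A) := fun i => by
    rw [Finset.sum_eq_single i (fun j _ hj => by rw [hD.1 i j k l hj.symm, zero_smul]) (by simp),
      Unitary.mul_star_self_of_mem (hu i)]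
  rw [blockTensor_apply, Finset.sum_congr rfl fun i _ => this i, ← Finset.sum_smul, hD.2,
    zero_smul, CStarMatrix.zero_apply]

/-- The same matrix unit placed in diagonal blocks `i` and `j` differs by an element of the subspace
that `f` kills. -/
theorem Matrix.density_eq_of_blockDiagonalSumZero
    {f : Matrix (Fin n × Fin p) (Fin n × Fin p) ℂ →ₗ[ℝ] ℝ}
    (hf : ∀ D ∈ blockDiagonalSumZero n p, f D = 0) (i j : Fin n) (k l : Fin p) :
    density f (i, k) (i, l) = density f (j, k) (j, l) := by
  have key : ∀ (c : ℂ) (k l : Fin p),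
      f (single (i, k) (i, l) c) = f (single (j, k) (j, l) c) := fun c k l => by
    rw [← sub_eq_zero, ← map_sub]
    refine hf _ ⟨fun a b r s hab => ?_, fun r s => ?_⟩
    · simp only [Matrix.sub_apply, single_apply, Prod.mk.injEq]
      grind
    · simp only [Matrix.sub_apply, single_apply, Prod.mk.injEq, Finset.sum_sub_distrib]
      by_cases h : k = r ∧ l = s <;> simp [h, ite_and]
  simp only [density, key]

end ElemTensor

/-! ### Testing positivity in representations -/

section Positivity
open Matrix
open scoped ComplexOrder Pointwise

variable {A : Type*} [CStarAlgebra A] [PartialOrder A] [StarOrderedRing A] {p n : ℕ}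

theorem NonUnitalCStarAlgebra.exists_eq_star_mul_self {E : Type*} [NonUnitalCStarAlgebra E]
    [PartialOrder E] [StarOrderedRing E] {a : E} (ha : 0 ≤ a) : ∃ b, a = star b * b :=
  CStarAlgebra.nonneg_iff_eq_star_mul_self.mp ha

/-- Writing `P = Q* Q` turns the sum into `∑ₘ ‖∑ₖ π(Qₘₖ) ξₖ‖²`. -/
theorem CStarMatrix.sum_inner_map_nonneg {H : Type*} [NormedAddCommGroup H]
    [InnerProductSpace ℂ H] [CompleteSpace H] {P : CStarMatrix (Fin p) (Fin p) A} (hP : 0 ≤ P)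
    (π : A →⋆ₐ[ℂ] (H →L[ℂ] H)) (ξ : Fin p → H) :
    0 ≤ ∑ k, ∑ l, inner ℂ (ξ k) (π (P k l) (ξ l)) := by
  obtain ⟨Q, rfl⟩ := NonUnitalCStarAlgebra.exists_eq_star_mul_self hP
  have : ∑ k, ∑ l, inner ℂ (ξ k) (π ((star Q * Q) k l) (ξ l)) =
      ∑ m, inner ℂ (∑ k, π (Q m k) (ξ k)) (∑ k, π (Q m k) (ξ k)) := by
    simp only [CStarMatrix.mul_apply, CStarMatrix.star_apply, map_sum, map_mul, map_star,
      _root_.sum_apply, mul_apply_eq_comp, inner_sum, sum_inner,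
      ContinuousLinearMap.star_eq_adjoint, ContinuousLinearMap.adjoint_inner_right]
    exact (Finset.sum_congr rfl fun k _ => Finset.sum_comm).trans
      (Finset.sum_comm.trans (Finset.sum_congr rfl fun m _ => Finset.sum_comm))
  rw [this]
  exact Finset.sum_nonneg fun m _ => by
    rw [inner_self_eq_norm_sq_to_K]
    norm_cast
    positivity

/-- If `∑ uᵢuⱼ* ⊗ Bᵢⱼ` is positive, then `∑ ⟨m_(i,k), m_(j,l)⟩ (Bᵢⱼ)ₖₗ` is nonnegative for all
vectors whose Gram matrix has equal diagonal blocks. -/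
theorem IsUniversalUnitaries.sum_mul_inner_nonneg {u : Fin n → A} (hu : IsUniversalUnitaries u)
    {B : Matrix (Fin n × Fin p) (Fin n × Fin p) ℂ} (hB : 0 ≤ blockTensor u B) {H : Type}
    [NormedAddCommGroup H] [InnerProductSpace ℂ H] [FiniteDimensional ℂ H] [Nontrivial H]
    (x : Fin n × Fin p → H)
    (hx : ∀ i j k l, inner ℂ (x (i, k)) (x (i, l)) = inner ℂ (x (j, k)) (x (j, l))) :
    0 ≤ ∑ a, ∑ b, B a b * inner ℂ (x a) (x b) := by
  have : CompleteSpace H := FiniteDimensional.complete ℂ H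
  rcases n with _ | n
  · simp
  choose U hU using fun i => exists_linearIsometryEquiv_of_inner_eq
    (fun k => x (0, k)) (fun k => x (i, k)) (hx 0 i)
  -- Adjoints are taken so that `π(uᵢuⱼ*) = Uᵢ* Uⱼ`, whose matrix coefficients at `x (0, k)`, `x (0,
  -- l)` are `⟨x (i, k), x (j, l)⟩`.
  let v : Fin (n + 1) → unitary (H →L[ℂ] H) := fun i =>
    star (Unitary.linearIsometryEquiv.symm (U i))
  obtain ⟨π, hπ, -⟩ := hu.2 H (fun i => v i) (fun i => (v i).2)
  convert CStarMatrix.sum_inner_map_nonneg hB π (fun k => x (0, k)) using 1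
  have hv : ∀ i j k l, inner ℂ (x (0, k)) (π (u i * star (u j)) (x (0, l))) =
      inner ℂ (x (i, k)) (x (j, l)) := fun i j k l => by
    rw [map_mul, map_star, hπ, hπ]
    simp only [v, Unitary.coe_star, star_star, Unitary.coe_symm_linearIsometryEquiv_apply,
      mul_apply_eq_comp]
    rw [ContinuousLinearMap.star_eq_adjoint, ContinuousLinearMap.adjoint_inner_right]
    exact congrArg₂ _ (hU i k) (hU j l)
  simp only [blockTensor_apply, map_sum, map_smul, _root_.sum_apply,
    _root_.smul_apply, inner_sum, inner_smul_right, hv, Fintype.sum_prod_type]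
  calc _ = ∑ i, ∑ k, ∑ l, ∑ j, B (i, k) (j, l) * inner ℂ (x (i, k)) (x (j, l)) :=
        Finset.sum_congr rfl fun i _ => Finset.sum_congr rfl fun k _ => Finset.sum_comm
    _ = ∑ k, ∑ i, ∑ l, ∑ j, B (i, k) (j, l) * inner ℂ (x (i, k)) (x (j, l)) := Finset.sum_comm
    _ = _ := Finset.sum_congr rfl fun k _ => Finset.sum_comm

theorem IsUniversalUnitaries.mem_posSemidef_add {u : Fin n → A} (hu : IsUniversalUnitaries u)
    {B : Matrix (Fin n × Fin p) (Fin n × Fin p) ℂ} (hB : 0 ≤ blockTensor u B)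
    (hB' : B.IsHermitian) :
    ∃ M D, B = M * Mᴴ + D ∧ D ∈ blockDiagonalSumZero n p := by
  by_cases hmem : B ∈ {B : Matrix (Fin n × Fin p) (Fin n × Fin p) ℂ | B.PosSemidef} +
      (blockDiagonalSumZero n p : Set (Matrix (Fin n × Fin p) (Fin n × Fin p) ℂ))
  · obtain ⟨C, hC, D, hD, rfl⟩ := hmem
    obtain ⟨M, rfl⟩ := PosSemidef.exists_eq_conjTranspose_mul_self hC
    exact ⟨Mᴴ, D, by simp, hD⟩
  exfalso
  obtain ⟨f, hfB, hf, hfD⟩ := exists_functional_of_notMem_posSemidef_add _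
    (fun D hD => trace_eq_zero_of_mem_blockDiagonalSumZero hD) hmem
  obtain ⟨M, hM⟩ := (posSemidef_density hf).exists_eq_conjTranspose_mul_self
  -- Universality only concerns nonzero Hilbert spaces, so the space spanned by this index set must
  -- be nontrivial.
  have : Nonempty (Fin n × Fin p) := by
    by_contra h
    rw [not_nonempty_iff] at h
    rw [Subsingleton.elim B 0, map_zero] at hfB
    exact hfB.false
  let x : Fin n × Fin p → EuclideanSpace ℂ (Fin n × Fin p) := fun a =>
    WithLp.toLp 2 fun c => M c a
  have hx : ∀ a b, inner ℂ (x a) (x b) = density f a b := fun a b => by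
    rw [hM, Matrix.mul_apply, PiLp.inner_apply]
    refine Finset.sum_congr rfl fun c _ => ?_
    simp [x, mul_comm]
  have := hu.sum_mul_inner_nonneg hB x fun i j k l => by
    rw [hx, hx, density_eq_of_blockDiagonalSumZero hfD]
  simp only [hx, sum_mul_density f hB'] at this
  exact hfB.not_ge (by exact_mod_cast this)

end Positivity

theorem mainTheorem8 (n p : ℕ) (u : Fin n → FullGroupCStar (FreeGroup (Fin n)))
    (hu : IsUniversalUnitaries u) (A : Fin n → Fin n → Matrix (Fin p) (Fin p) ℂ) :
    0 ≤ ∑ i, ∑ j, elemTensor (u i * star (u j)) (A i j) ↔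
      ∃ X : Fin n → Fin n → Matrix (Fin p) (Fin p) ℂ,
        ∑ i, ∑ j, elemTensor (u i * star (u j)) (A i j) =
          ∑ k, (∑ i, elemTensor (u i) (X i k)) * star (∑ i, elemTensor (u i) (X i k)) := by
  constructor
  · intro hP
    let B : Matrix (Fin n × Fin p) (Fin n × Fin p) ℂ :=
      Matrix.of fun a b => A a.1 b.1 a.2 b.2
    have hB : ∑ i, ∑ j, elemTensor (u i * star (u j)) (A i j) = blockTensor u B := rfl
    rw [hB] at hP ⊢
    -- `B` need not be Hermitian, but `P` is self-adjoint, so the Hermitian part of `B` represents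
    -- the same element.
    let C : Matrix (Fin n × Fin p) (Fin n × Fin p) ℂ := (1 / 2 : ℂ) • (B + B.conjTranspose)
    have hC : C.IsHermitian := by
      ext a b
      simp [C, add_comm]
    have hBC : blockTensor u B = blockTensor u C := by
      rw [blockTensor_smul, blockTensor_add, blockTensor_conjTranspose,
        (IsSelfAdjoint.of_nonneg hP).star_eq, ← two_smul ℂ, smul_smul]
      norm_num
    rw [hBC] at hP ⊢
    obtain ⟨M, D, hMD, hD⟩ := hu.mem_posSemidef_add hP hC
    refine ⟨fun i m => Matrix.of fun k q => M (i, k) (m, q), ?_⟩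
    rw [hMD, blockTensor_add, blockTensor_eq_zero hu.1 hD, add_zero, blockTensor_mul_conjTranspose]
  · rintro ⟨X, hX⟩
    rw [hX]
    exact Finset.sum_nonneg fun k _ => mul_star_self_nonneg _
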